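/- A continuum is a nonempty compact connected metric space, and a subcontinuum of $X$ is a nonempty compact connected subset of $X$. A continuum is indecomposable if it is not the union of two of its proper subcontinua. A continuum $X$ is hereditarily unicoherent if $A\cap B$ is connected (possibly empty) for all subcontinua $A,B$ of $X$. For $x\in X$, the meager composant of $x$ is $$M_x=\bigcup\{L\subset X : L \text{ is a subcontinuum of } X,\ L\text{ is nowhere dense in }X,\ x\in L\}.$$ A dendrite is a locally connected continuum that contains no simple closed curve (no subspace homeomorphic to the circle). Theorem. Let $X$ be a hereditarily unicoherent continuum in which every indecomposable subcontinuum is nowhere dense. Then $\mathcal M_X=\{M_x : x\in X\}$ is an upper semi-continuous decomposition of $X$, that is, $\mathcal M_X$ is a partition of $X$ into nonempty pairwise disjoint sets and $\bigcup\{M_x : x\in A\}$ is closed in $X$ for every closed $A\subset X$; and $\mathcal M_X$ with the quotient topology is a (metrizable) dendrite, possibly consisting of a single point. -/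

import Mathlib

/-- A subcontinuum of a (metrizable) space: a nonempty, compact, connected subset. -/
def IsSubcontinuum {X : Type*} [TopologicalSpace X] (K : Set X) : Prop :=
  IsCompact K ∧ IsConnected K

/-- The intersection of any two subcontinua is connected (possibly empty). -/
def HereditarilyUnicoherent (X : Type*) [TopologicalSpace X] : Prop :=
  ∀ A B : Set X, IsSubcontinuum A → IsSubcontinuum B → IsPreconnected (A ∩ B)

/-- A subcontinuum which is the union of two of its proper subcontinua. -/
def IsDecomposableSubcontinuum {X : Type*} [TopologicalSpace X] (K : Set X) : Prop :=
  IsSubcontinuum K ∧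
    ∃ A B : Set X, IsSubcontinuum A ∧ IsSubcontinuum B ∧ A ≠ K ∧ B ≠ K ∧ A ∪ B = K

/-- A subcontinuum which is not decomposable. -/
def IsIndecomposableSubcontinuum {X : Type*} [TopologicalSpace X] (K : Set X) : Prop :=
  IsSubcontinuum K ∧ ¬ IsDecomposableSubcontinuum K

/-- The meager composant of `x`: the union of all subcontinua of `X` that contain `x` and are
nowhere dense in `X`. -/
def meagerComposant {X : Type*} [TopologicalSpace X] (x : X) : Set X :=
  ⋃₀ {L : Set X | IsSubcontinuum L ∧ IsNowhereDense L ∧ x ∈ L}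

/-- The collection of all meager composants of `X`. -/
def meagerComposants (X : Type*) [TopologicalSpace X] : Set (Set X) :=
  {M : Set X | ∃ x : X, M = meagerComposant x}

/-- The space whose points are the meager composants of `X`. -/
def MeagerComposantSpace (X : Type*) [TopologicalSpace X] : Type _ :=
  {M : Set X // M ∈ meagerComposants X}

/-- The map sending `x` to its meager composant, as a point of the space of meager composants. -/
def MeagerComposantSpace.mk {X : Type*} [TopologicalSpace X] (x : X) : MeagerComposantSpace X :=
  ⟨meagerComposant x, x, rfl⟩

/-- The quotient topology: a set of meager composants is open iff its preimage under
`x ↦ meagerComposant x` is open in `X`. -/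
instance MeagerComposantSpace.instTopologicalSpace (X : Type*) [t : TopologicalSpace X] :
    TopologicalSpace (MeagerComposantSpace X) :=
  TopologicalSpace.coinduced MeagerComposantSpace.mk t

/-- A dendrite: a locally connected continuum (compact connected metrizable space) that contains
no simple closed curve (no subspace homeomorphic to the circle). -/
structure IsDendrite (Y : Type*) [TopologicalSpace Y] : Prop where
  compact : CompactSpace Y
  connected : ConnectedSpace Y
  metrizable : TopologicalSpace.MetrizableSpace Y
  locallyConnected : LocallyConnectedSpace Y
  no_simple_closed_curve : ∀ S : Set Y, ¬ Nonempty (S ≃ₜ Circle)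

open Set Topology

/-! The heart is a continuous real function that separates two given meager composants and is
constant on each meager composant. If `y ∉ meagerComposant x`, the least subcontinuum containing
both points (it exists by hereditary unicoherence) has nonempty interior `V`, so every continuum
joining them contains `V`. The hull of a nonempty open `V` is not nowhere dense, hence decomposable,
and its two pieces yield two open subsets of `V` lying in order between the ends
(`CutsThrough.split`). Repeated splitting leaves room for an intermediate open set
(`CutsOff.interpolate`), which is what Urysohn's construction needs. No nowhere dense continuum
crosses between two levels, so the limit function is constant on it.

Hence the quotient is Hausdorff and the quotient map is closed with connected fibers. This gives
upper semicontinuity, metrizability and hereditary unicoherence of the quotient, which excludes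
circles. Interpolation also gives a point common to all continua joining suitable neighborhoods of
two points; with boundary bumping, this forces local connectedness. -/

theorem IsSubcontinuum.union {X : Type*} [TopologicalSpace X] {A B : Set X}
    (hA : IsSubcontinuum A) (hB : IsSubcontinuum B) (h : (A ∩ B).Nonempty) :
    IsSubcontinuum (A ∪ B) :=
  ⟨hA.1.union hB.1, hA.2.union h hB.2⟩

theorem isSubcontinuum_singleton {X : Type*} [TopologicalSpace X] (x : X) :
    IsSubcontinuum ({x} : Set X) :=
  ⟨isCompact_singleton, isConnected_singleton⟩

/-! ### Hulls, separations and boundary bumping -/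

theorem isSubcontinuum_connectedComponentIn {X : Type*} [TopologicalSpace X] [CompactSpace X]
    {K : Set X} (hK : IsClosed K) {y : X} (hy : y ∈ K) :
    IsSubcontinuum (connectedComponentIn K y) := by
  refine ⟨?_, isConnected_connectedComponentIn_iff.2 hy⟩
  refine (isClosed_of_closure_subset ?_).isCompact
  refine isPreconnected_connectedComponentIn.closure.subset_connectedComponentIn
    (subset_closure (mem_connectedComponentIn hy)) ?_
  exact closure_minimal (connectedComponentIn_subset K y) hK

/-- The smallest subcontinuum containing a nonempty set, in a hereditarily unicoherent
continuum. -/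
theorem HereditarilyUnicoherent.isSubcontinuum_hull {X : Type*} [TopologicalSpace X] [T2Space X]
    [CompactSpace X] [ConnectedSpace X] (hX : HereditarilyUnicoherent X) {S : Set X}
    (hS : S.Nonempty) : IsSubcontinuum (⋂₀ {L : Set X | IsSubcontinuum L ∧ S ⊆ L}) := by
  set N := ⋂₀ {L : Set X | IsSubcontinuum L ∧ S ⊆ L} with hN
  have hNc : IsClosed N := isClosed_sInter fun L hL => hL.1.1.isClosed
  have hSN : S ⊆ N := fun x hx L hL => hL.2 hx
  refine ⟨hNc.isCompact, hS.mono hSN, isPreconnected_closed_iff.2 ?_⟩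
  intro u v hu hv huv hNu hNv
  by_contra hemp
  have hd : Disjoint (N ∩ u) (N ∩ v) := by
    rw [Set.disjoint_left]
    rintro x ⟨h1, h2⟩ ⟨_, h3⟩
    exact hemp ⟨x, h1, h2, h3⟩
  obtain ⟨O₁, O₂, hO₁, hO₂, h1, h2, hO⟩ :=
    normal_separation (hNc.inter hu) (hNc.inter hv) hd
  have : Nonempty {L : Set X // IsSubcontinuum L ∧ S ⊆ L} :=
    ⟨⟨univ, ⟨isCompact_univ, isConnected_univ⟩, subset_univ _⟩⟩
  -- Unicoherence makes the family directed under intersection, so by compactness a single member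
  -- already lies in `O₁ ∪ O₂`.
  have hV := exists_subset_nhds_of_isCompact
    (V := fun L : {L : Set X // IsSubcontinuum L ∧ S ⊆ L} => (L : Set X)) (U := O₁ ∪ O₂)
    (by
      rintro ⟨A, hA, hSA⟩ ⟨B, hB, hSB⟩
      refine ⟨⟨A ∩ B, ⟨hA.1.inter hB.1, hS.mono (subset_inter hSA hSB), hX A B hA hB⟩,
        subset_inter hSA hSB⟩, inter_subset_left, inter_subset_right⟩)
    (fun L => L.2.1.1)
    (by
      intro x hx
      have hxN : x ∈ N := fun L hL => mem_iInter.1 hx ⟨L, hL⟩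
      refine (hO₁.union hO₂).mem_nhds ?_
      rcases huv hxN with h | h
      · exact Or.inl (h1 ⟨hxN, h⟩)
      · exact Or.inr (h2 ⟨hxN, h⟩))
  obtain ⟨⟨L, hL, hSL⟩, hLO⟩ := hV
  have hNL : N ⊆ L := sInter_subset_of_mem ⟨hL, hSL⟩
  obtain ⟨x, -, hx1, hx2⟩ := hL.2.2 O₁ O₂ hO₁ hO₂ hLO
    (hNu.mono fun x hx => ⟨hNL hx.1, h1 hx⟩) (hNv.mono fun x hx => ⟨hNL hx.1, h2 hx⟩)
  exact Set.disjoint_left.1 hO hx1 hx2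

/-- If no connected subset of a closed set `K` joins `y` to the closed set `T`, then `K` splits
into two disjoint closed sets, one containing `y` and the other containing `T`. -/
theorem exists_closed_separation {X : Type*} [TopologicalSpace X] [T2Space X]
    [CompactSpace X] {K T : Set X} {y : X} (hK : IsClosed K) (hy : y ∈ K) (hT : IsClosed T)
    (hTK : T ⊆ K) (h : Disjoint (connectedComponentIn K y) T) :
    ∃ P Q : Set X, IsClosed P ∧ IsClosed Q ∧ Disjoint P Q ∧ P ∪ Q = K ∧ y ∈ P ∧ T ⊆ Q := by
  have : CompactSpace K := isCompact_iff_compactSpace.1 hK.isCompact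
  let T' : Set K := Subtype.val ⁻¹' T
  have hT' : IsClosed T' := hT.preimage continuous_subtype_val
  have hd : connectedComponent (⟨y, hy⟩ : K) ⊆ T'ᶜ := by
    intro z hz hzT
    refine Set.disjoint_left.1 h ?_ hzT
    rw [connectedComponentIn_eq_image hy]
    exact ⟨z, hz, rfl⟩
  -- Components are quasi-components here, so by compactness one clopen set around `y` misses `T`.
  rw [connectedComponent_eq_iInter_isClopen] at hd
  have : Nonempty {s : Set K // IsClopen s ∧ (⟨y, hy⟩ : K) ∈ s} :=
    ⟨⟨univ, isClopen_univ, mem_univ _⟩⟩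
  obtain ⟨⟨Z, hZ, hyZ⟩, hZT⟩ := exists_subset_nhds_of_isCompact
    (V := fun s : {s : Set K // IsClopen s ∧ (⟨y, hy⟩ : K) ∈ s} => (s : Set K)) (U := T'ᶜ)
    (by
      rintro ⟨A, hA, hyA⟩ ⟨B, hB, hyB⟩
      exact ⟨⟨A ∩ B, hA.inter hB, hyA, hyB⟩, inter_subset_left, inter_subset_right⟩)
    (fun s => s.2.1.1.isCompact) (fun x hx => hT'.isOpen_compl.mem_nhds (hd hx))
  refine ⟨Subtype.val '' Z, Subtype.val '' Zᶜ, hK.isClosedMap_subtype_val _ hZ.1,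
    hK.isClosedMap_subtype_val _ hZ.compl.1, ?_, ?_, ⟨_, hyZ, rfl⟩, ?_⟩
  · exact (disjoint_image_iff Subtype.val_injective).2 disjoint_compl_right
  · rw [← image_union, union_compl_self, image_univ, Subtype.range_coe]
  · intro t ht
    exact ⟨⟨t, hTK ht⟩, fun hz => hZT hz ht, rfl⟩

/-- If the complement of a connected closed set `C` in a connected space splits into two
pieces, each of them together with `C` is connected. -/
theorem isConnected_union_of_compl_subset {X : Type*} [TopologicalSpace X] [ConnectedSpace X]
    {C P Q : Set X} (hC : IsConnected C) (hCc : IsClosed C) (hP : IsClosed P) (hQ : IsClosed Q)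
    (hPQ : Disjoint P Q) (h : C ∪ P ∪ Q = univ) : IsConnected (C ∪ P) := by
  refine ⟨hC.1.mono subset_union_left, ?_⟩
  have key : ∀ u v : Set X, IsClosed u → IsClosed v → C ∪ P ⊆ u ∪ v → C ⊆ u →
      ((C ∪ P) ∩ v).Nonempty → ((C ∪ P) ∩ (u ∩ v)).Nonempty := by
    intro u v hu hv huv hCu hv'
    by_contra hemp
    -- Since `C ⊆ u`, this set lies in `P` if it misses `u`; it would then be split off from the
    -- rest of the space, `Q` included.
    have hE : IsClosed ((C ∪ P) ∩ v) := (hCc.union hP).inter hv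
    have hF : IsClosed (((C ∪ P) ∩ u) ∪ Q) := ((hCc.union hP).inter hu).union hQ
    obtain ⟨x, -, hx⟩ := isPreconnected_closed_iff.1 (isPreconnected_univ (α := X)) _ _ hE hF
      (by
        intro x _
        rcases (h ▸ mem_univ x : x ∈ C ∪ P ∪ Q) with hx | hx
        · rcases huv hx with h' | h'
          · exact Or.inr (Or.inl ⟨hx, h'⟩)
          · exact Or.inl ⟨hx, h'⟩
        · exact Or.inr (Or.inr hx))
      (by simpa using hv')
      (by
        obtain ⟨c, hc⟩ := hC.1
        exact ⟨c, trivial, Or.inl ⟨Or.inl hc, hCu hc⟩⟩)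
    rcases hx.2 with h' | h'
    · exact hemp ⟨x, hx.1.1, h'.2, hx.1.2⟩
    · rcases hx.1.1 with h'' | h''
      · exact hemp ⟨x, hx.1.1, hCu h'', hx.1.2⟩
      · exact Set.disjoint_left.1 hPQ h'' h'
  refine isPreconnected_closed_iff.2 fun u v hu hv huv hu' hv' => ?_
  by_cases hmeet : (C ∩ (u ∩ v)).Nonempty
  · exact hmeet.mono (inter_subset_inter_left _ subset_union_left)
  have hCuv := isPreconnected_closed_iff.1 hC.2 u v hu hv (subset_union_left.trans huv)
  by_cases hCu : (C ∩ u).Nonempty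
  · by_cases hCv : (C ∩ v).Nonempty
    · exact absurd (hCuv hCu hCv) hmeet
    · refine key u v hu hv huv (fun x hx => ?_) hv'
      exact (huv (Or.inl hx)).resolve_right fun hxv => hCv ⟨x, hx, hxv⟩
  · rw [inter_comm u v]
    refine key v u hv hu (by rwa [union_comm v u]) (fun x hx => ?_) hu'
    exact (huv (Or.inl hx)).resolve_left fun hxu => hCu ⟨x, hx, hxu⟩

/-- Boundary bumping. -/
theorem connectedComponentIn_inter_frontier_nonempty {X : Type*} [TopologicalSpace X]
    [T2Space X] [CompactSpace X] [ConnectedSpace X] {U : Set X} (hU : IsOpen U)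
    (hne : U ≠ univ) {t : X} (ht : t ∈ U) :
    (connectedComponentIn (closure U) t ∩ frontier U).Nonempty := by
  by_contra hemp
  obtain ⟨P, Q, hP, hQ, hPQ, hK, htP, hQf⟩ := exists_closed_separation isClosed_closure
    (subset_closure ht) isClosed_frontier frontier_subset_closure
    (Set.disjoint_iff_inter_eq_empty.2 (not_nonempty_iff_eq_empty.1 hemp))
  -- `P` misses the frontier, so it is open as well as closed in the whole space.
  have hPU : P = U ∩ Qᶜ := by
    ext x
    constructor
    · intro hx
      have hxQ : x ∉ Q := Set.disjoint_left.1 hPQ hx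
      refine ⟨?_, hxQ⟩
      by_contra hxU
      refine hxQ (hQf ?_)
      rw [hU.frontier_eq]
      exact ⟨hK ▸ Or.inl hx, hxU⟩
    · rintro ⟨hx, hxQ⟩
      exact (hK.symm ▸ subset_closure hx : x ∈ P ∪ Q).resolve_right hxQ
  have hclop : IsClopen P := ⟨hP, hPU ▸ hU.inter hQ.isOpen_compl⟩
  have := hclop.eq_univ ⟨t, htP⟩
  refine hne (eq_univ_of_univ_subset ?_)
  rw [← this, hPU]
  exact inter_subset_left

/-! ### Open sets contained in every joining continuum -/

/-- Every subcontinuum meeting both `c` and `d` contains `V`. -/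
def CutsThrough {X : Type*} [TopologicalSpace X] (V c d : Set X) : Prop :=
  ∀ L : Set X, IsSubcontinuum L → (L ∩ c).Nonempty → (L ∩ d).Nonempty → V ⊆ L

section

variable {X : Type*} [TopologicalSpace X]

theorem CutsThrough.symm {V c d : Set X} (h : CutsThrough V c d) : CutsThrough V d c :=
  fun L hL h1 h2 => h L hL h2 h1

theorem CutsThrough.mono {V W c d : Set X} (h : CutsThrough V c d) (hW : W ⊆ V) :
    CutsThrough W c d :=
  fun L hL h1 h2 => hW.trans (h L hL h1 h2)

variable [T2Space X] [CompactSpace X] [ConnectedSpace X]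

/-- `L ∪ A` meets `c` but misses a point `p` of `V \ A`, so it misses `d`. Take for `D` the
component of `y` off `V \ B`. If it missed `B`, the part of a separation around `y` could be added
to `L ∪ A`, giving a continuum from `c` to `d` that still misses `p`. -/
theorem CutsThrough.exists_continuum_avoiding {V c d A B L : Set X} (hV : IsOpen V)
    (h : CutsThrough V c d) (hA : IsSubcontinuum A) (hB : IsSubcontinuum B) (hVAB : V ⊆ A ∪ B)
    (hL : IsSubcontinuum L) (hLc : (L ∩ c).Nonempty) (hLA : (L ∩ A).Nonempty)
    (hL' : ¬ V \ A ⊆ L) {y : X} (hy : y ∈ d) :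
    ∃ D, IsSubcontinuum D ∧ y ∈ D ∧ (D ∩ B).Nonempty ∧ Disjoint D (V \ B) := by
  obtain ⟨p, ⟨hpV, hpA⟩, hpL⟩ := not_subset.1 hL'
  have hC : IsSubcontinuum (L ∪ A) := hL.union hA hLA
  have hCc : ((L ∪ A) ∩ c).Nonempty := hLc.mono (inter_subset_inter_left _ subset_union_left)
  have hpC : p ∉ L ∪ A := fun hp => hp.elim hpL hpA
  have hyC : y ∉ L ∪ A := fun hyC => hpC (h _ hC hCc ⟨y, hyC, hy⟩ hpV)
  have hVA : V \ B ⊆ A := fun x hx => (hVAB hx.1).resolve_right hx.2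
  have hyV : y ∈ (V \ B)ᶜ := fun hx => hyC (Or.inr (hVA hx))
  have hKc : IsClosed (V \ B)ᶜ := (hV.sdiff hB.1.isClosed).isClosed_compl
  refine ⟨connectedComponentIn (V \ B)ᶜ y, isSubcontinuum_connectedComponentIn hKc hyV,
    mem_connectedComponentIn hyV, ?_,
    disjoint_left.2 fun x hx => connectedComponentIn_subset _ _ hx⟩
  by_contra hemp
  obtain ⟨P, Q, hP, hQ, hPQ, hK, hyP, hBQ⟩ := exists_closed_separation hKc hyV hB.1.isClosed
    (fun x hx hx' => hx'.2 hx) (disjoint_iff_inter_eq_empty.2 (not_nonempty_iff_eq_empty.1 hemp))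
  have hcon : IsConnected (L ∪ A ∪ P) :=
    isConnected_union_of_compl_subset hC.2 hC.1.isClosed hP hQ hPQ (by
      refine eq_univ_of_forall fun x => ?_
      by_cases hx : x ∈ V \ B
      · exact Or.inl (Or.inl (Or.inr (hVA hx)))
      · rcases (hK.symm ▸ hx : x ∈ P ∪ Q) with h' | h'
        · exact Or.inl (Or.inr h')
        · exact Or.inr h')
  have hp := h _ ⟨hC.1.union hP.isCompact, hcon⟩
    (hCc.mono (inter_subset_inter_left _ subset_union_left)) ⟨y, Or.inr hyP, hy⟩ hpV
  have hpP : p ∈ P := hp.resolve_left hpC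
  exact disjoint_left.1 hPQ hpP (hBQ ((hVAB hpV).resolve_left hpA))

theorem CutsThrough.of_cutsThrough_left {V c d A B : Set X} (hV : IsOpen V)
    (h : CutsThrough V c d) (hA : IsSubcontinuum A) (hB : IsSubcontinuum B) (hVAB : V ⊆ A ∪ B)
    (hVB : (V \ B).Nonempty) (hc : c.Nonempty) (h1 : CutsThrough (V \ B) c B) :
    CutsThrough (V \ A) d A := by
  intro L hL hLd hLA
  by_contra hL'
  obtain ⟨x, hx⟩ := hc
  obtain ⟨D, hD, hxD, hDB, hDV⟩ :=
    h.symm.exists_continuum_avoiding hV hA hB hVAB hL hLd hLA hL' hx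
  obtain ⟨p, hp⟩ := hVB
  exact disjoint_left.1 hDV (h1 D hD ⟨x, hxD, hx⟩ hDB hp) hp

/-- Decides which piece comes first from `c`. If both alternatives fail, a continuum from `c` to
`B`, then `B`, then one from `B` to `d` avoiding `V \ B` join `c` to `d` while missing a point of
`V`. -/
theorem CutsThrough.cutsThrough_or {V c d A B : Set X} (hV : IsOpen V)
    (h : CutsThrough V c d) (hA : IsSubcontinuum A) (hB : IsSubcontinuum B) (hVAB : V ⊆ A ∪ B)
    (hd : d.Nonempty) : CutsThrough (V \ B) c B ∨ CutsThrough (V \ A) c A := by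
  by_contra! hcon
  obtain ⟨h1, h2⟩ := hcon
  unfold CutsThrough at h1 h2
  push Not at h1 h2
  obtain ⟨L₁, hL₁, hL₁c, hL₁B, hL₁'⟩ := h1
  obtain ⟨L₂, hL₂, hL₂c, hL₂A, hL₂'⟩ := h2
  obtain ⟨y, hy⟩ := hd
  obtain ⟨D, hD, hyD, hDB, hDV⟩ :=
    h.exists_continuum_avoiding hV hA hB hVAB hL₂ hL₂c hL₂A hL₂' hy
  obtain ⟨p, hp, hpL⟩ := not_subset.1 hL₁'
  have hE : IsSubcontinuum (L₁ ∪ B ∪ D) :=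
    (hL₁.union hB hL₁B).union hD (by
      obtain ⟨z, hz1, hz2⟩ := hDB
      exact ⟨z, Or.inr hz2, hz1⟩)
  obtain ⟨x, hx1, hx2⟩ := hL₁c
  rcases h _ hE ⟨x, Or.inl (Or.inl hx1), hx2⟩ ⟨y, Or.inr hyD, hy⟩ hp.1 with (h' | h') | h'
  · exact hpL h'
  · exact hp.2 h'
  · exact disjoint_left.1 hDV h' hp

/-- Decompose the hull of `V` as `A ∪ B`. By minimality neither piece contains `V`, and `V \ B`, `V
\ A` are the two sets, in an order set by `cutsThrough_or`. -/
theorem CutsThrough.split (hX : HereditarilyUnicoherent X)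
    (hind : ∀ K : Set X, IsIndecomposableSubcontinuum K → IsNowhereDense K)
    {V c d : Set X} (hV : IsOpen V) (hVne : V.Nonempty) (hc : c.Nonempty) (hd : d.Nonempty)
    (h : CutsThrough V c d) :
    ∃ V₁ V₂ : Set X, IsOpen V₁ ∧ IsOpen V₂ ∧ V₁.Nonempty ∧ V₂.Nonempty ∧ V₁ ⊆ V ∧ V₂ ⊆ V ∧
      CutsThrough V₁ c V₂ ∧ CutsThrough V₂ d V₁ := by
  set N := ⋂₀ {L : Set X | IsSubcontinuum L ∧ V ⊆ L} with hN
  have hNs : IsSubcontinuum N := hX.isSubcontinuum_hull hVne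
  have hVN : V ⊆ N := fun x hx L hL => hL.2 hx
  have hnd : ¬ IsNowhereDense N := by
    intro hnd
    rw [IsNowhereDense, hNs.1.isClosed.closure_eq] at hnd
    obtain ⟨x, hx⟩ := hVne
    exact (hnd ▸ interior_maximal hVN hV hx : x ∈ (∅ : Set X))
  have hdec : IsDecomposableSubcontinuum N := by
    by_contra hdec
    exact hnd (hind N ⟨hNs, hdec⟩)
  obtain ⟨-, A, B, hA, hB, hAN, hBN, hAB⟩ := hdec
  have key : ∀ A, IsSubcontinuum A → A ⊆ N → A ≠ N → (V \ A).Nonempty := by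
    intro A hA hAN hne
    by_contra hemp
    refine hne (hAN.antisymm (sInter_subset_of_mem ⟨hA, ?_⟩))
    exact sdiff_eq_empty.1 (not_nonempty_iff_eq_empty.1 hemp)
  have hVA := key A hA (hAB ▸ subset_union_left) hAN
  have hVB := key B hB (hAB ▸ subset_union_right) hBN
  have hVAB : V ⊆ A ∪ B := hAB ▸ hVN
  have hVBA : V ⊆ B ∪ A := by rwa [union_comm]
  have fin : ∀ A B : Set X, IsSubcontinuum A → IsSubcontinuum B → V ⊆ A ∪ B →
      (V \ A).Nonempty → (V \ B).Nonempty → CutsThrough (V \ B) c B →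
      ∃ V₁ V₂ : Set X, IsOpen V₁ ∧ IsOpen V₂ ∧ V₁.Nonempty ∧ V₂.Nonempty ∧ V₁ ⊆ V ∧ V₂ ⊆ V ∧
      CutsThrough V₁ c V₂ ∧ CutsThrough V₂ d V₁ := by
    intro A B hA hB hVAB hVA hVB h1
    have h2 := h.of_cutsThrough_left hV hA hB hVAB hVB hc h1
    refine ⟨V \ B, V \ A, hV.sdiff hB.1.isClosed, hV.sdiff hA.1.isClosed, hVB, hVA,
      sdiff_subset, sdiff_subset, ?_, ?_⟩
    · exact fun L hL hLc hLV => h1 L hL hLc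
        (hLV.mono (inter_subset_inter_right _ fun x hx => (hVAB hx.1).resolve_left hx.2))
    · exact fun L hL hLc hLV => h2 L hL hLc
        (hLV.mono (inter_subset_inter_right _ fun x hx => (hVAB hx.1).resolve_right hx.2))
  rcases h.cutsThrough_or hV hA hB hVAB hd with h' | h'
  · exact fin A B hA hB hVAB hVA hVB h'
  · exact fin B A hB hA hVBA hVB hVA h'

omit [ConnectedSpace X] in
/-- A point in the closure of the union of the subcontinua that meet the closed set `c` and do
not contain `V` is joined to `c` by a subcontinuum missing `W`. -/
theorem exists_continuum_of_mem_closure {V W c : Set X} (hW : IsOpen W) (hc : IsClosed c) (h : CutsThrough V c W) {z : X}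
    (hz : z ∈ closure (⋃₀ {L | IsSubcontinuum L ∧ (L ∩ c).Nonempty ∧ ¬ V ⊆ L})) :
    ∃ L, IsSubcontinuum L ∧ (L ∩ c).Nonempty ∧ z ∈ L ∧ Disjoint L W := by
  have hLW : ∀ L, IsSubcontinuum L → (L ∩ c).Nonempty → ¬ V ⊆ L → L ⊆ Wᶜ :=
    fun L hL hLc hLV x hx hxW => hLV (h L hL hLc ⟨x, hx, hxW⟩)
  have hzW : z ∈ Wᶜ :=
    closure_minimal (sUnion_subset fun L hL => hLW L hL.1 hL.2.1 hL.2.2) hW.isClosed_compl hz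
  refine ⟨connectedComponentIn Wᶜ z, isSubcontinuum_connectedComponentIn hW.isClosed_compl hzW,
    ?_, mem_connectedComponentIn hzW,
    disjoint_left.2 fun x hx => connectedComponentIn_subset _ _ hx⟩
  by_contra hemp
  obtain ⟨P, Q, hP, hQ, hPQ, hK, hzP, hcQ⟩ := exists_closed_separation hW.isClosed_compl hzW
    (hc.inter hW.isClosed_compl) inter_subset_right (disjoint_left.2 fun x hx hx' =>
      hemp ⟨x, hx, hx'.1⟩)
  obtain ⟨t, htQ, L, ⟨hL, ⟨s, hsL, hsc⟩, hLV⟩, htL⟩ := mem_closure_iff.1 hz Qᶜ hQ.isOpen_compl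
    (disjoint_left.1 hPQ hzP)
  have hLW' := hLW L hL ⟨s, hsL, hsc⟩ hLV
  obtain ⟨x, -, hxP, hxQ⟩ := isPreconnected_closed_iff.1 hL.2.2 P Q hP hQ (hK ▸ hLW')
    ⟨t, htL, (hK.symm ▸ hLW' htL : t ∈ P ∪ Q).resolve_right htQ⟩
    ⟨s, hsL, hcQ ⟨hsc, hLW' hsL⟩⟩
  exact disjoint_left.1 hPQ hxP hxQ

/-! ### Urysohn interpolation for the cutting relation -/

variable [Nontrivial X]

/-- The relation fed into the proof of Urysohn's lemma. -/
def CutsOff (c u : Set X) : Prop :=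
  c.Nonempty ∧ uᶜ.Nonempty ∧ ∃ V : Set X, IsOpen V ∧ V.Nonempty ∧ CutsThrough V c uᶜ

theorem CutsOff.interpolate (hX : HereditarilyUnicoherent X)
    (hind : ∀ K : Set X, IsIndecomposableSubcontinuum K → IsNowhereDense K)
    {c u : Set X} (hc : IsClosed c) (h : CutsOff c u) (hu : IsOpen u) :
    ∃ v : Set X, IsOpen v ∧ c ⊆ v ∧ closure v ⊆ u ∧ CutsOff c v ∧ CutsOff (closure v) u := by
  obtain ⟨hcne, hdne, V, hV, hVne, hcut⟩ := h
  have hd : IsClosed uᶜ := hu.isClosed_compl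
  generalize hde : uᶜ = d at hdne hcut hd
  have sub : ∀ {V₁ : Set X} {x : X}, IsOpen V₁ → V₁.Nonempty → ¬ V₁ ⊆ {x} := by
    intro V₁ x hV₁ hne hsub
    have heq : V₁ = {x} := (Nonempty.subset_singleton_iff hne).1 hsub
    exact not_isOpen_singleton x (heq ▸ hV₁)
  -- From `c` to `d` the order is `V₁₁`, `V₁₂`, `V₂₁`, `V₂₂`. The outer sets witness the two new
  -- relations; the inner ones keep `closure F` and `closure G` apart.
  obtain ⟨V₁, V₂, hV₁, hV₂, hV₁ne, hV₂ne, hV₁V, hV₂V, h12, h21⟩ :=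
    hcut.split hX hind hV hVne hcne hdne
  obtain ⟨V₁₁, V₁₂, ho₁₁, ho₁₂, hn₁₁, hn₁₂, hs₁₁, hs₁₂, h1, -⟩ :=
    (hcut.mono hV₁V).split hX hind hV₁ hV₁ne hcne hdne
  obtain ⟨V₂₁, V₂₂, ho₂₁, ho₂₂, hn₂₁, hn₂₂, hs₂₁, hs₂₂, -, h2⟩ :=
    (hcut.mono hV₂V).split hX hind hV₂ hV₂ne hcne hdne
  set F := ⋃₀ {L | IsSubcontinuum L ∧ (L ∩ c).Nonempty ∧ ¬ V₁₁ ⊆ L} with hF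
  set G := ⋃₀ {L | IsSubcontinuum L ∧ (L ∩ d).Nonempty ∧ ¬ V₂₂ ⊆ L} with hG
  have hFG : Disjoint (closure F) (closure G) := by
    rw [disjoint_left]
    intro z hzF hzG
    obtain ⟨L₁, hL₁, ⟨s, hsL, hsc⟩, hzL₁, hd₁⟩ :=
      exists_continuum_of_mem_closure ho₁₂ hc h1 hzF
    obtain ⟨L₂, hL₂, ⟨t, htL, htd⟩, hzL₂, hd₂⟩ :=
      exists_continuum_of_mem_closure ho₂₁ hd h2 hzG
    have hE := hcut _ (hL₁.union hL₂ ⟨z, hzL₁, hzL₂⟩) ⟨s, Or.inl hsL, hsc⟩ ⟨t, Or.inr htL, htd⟩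
    obtain ⟨p, hp⟩ := hn₂₁
    have hpL : p ∈ L₁ :=
      (hE (hV₂V (hs₂₁ hp))).resolve_right fun h' => disjoint_left.1 hd₂ h' hp
    obtain ⟨q, hq⟩ := hn₁₂
    exact disjoint_left.1 hd₁ (h12 L₁ hL₁ ⟨s, hsL, hsc⟩ ⟨p, hpL, hs₂₁ hp⟩ (hs₁₂ hq)) hq
  have hcF : c ⊆ F := fun x hx => ⟨{x}, ⟨isSubcontinuum_singleton x, ⟨x, rfl, hx⟩,
    sub ho₁₁ hn₁₁⟩, rfl⟩
  have hdG : d ⊆ G := fun x hx => ⟨{x}, ⟨isSubcontinuum_singleton x, ⟨x, rfl, hx⟩,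
    sub ho₂₂ hn₂₂⟩, rfl⟩
  obtain ⟨v, hv, hFv, hvG⟩ := normal_exists_closure_subset isClosed_closure
    isClosed_closure.isOpen_compl (disjoint_left.1 hFG : closure F ⊆ (closure G)ᶜ)
  have hvd : closure v ⊆ dᶜ := fun x hx hxd => hvG hx (subset_closure (hdG hxd))
  have hcv : c ⊆ v := hcF.trans (subset_closure.trans hFv)
  have hdv : d ⊆ vᶜ := fun x hx hxv => hvd (subset_closure hxv) hx
  refine ⟨v, hv, hcv, ?_, ⟨hcne, hdne.mono hdv, V₁₁, ho₁₁, hn₁₁, ?_⟩,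
    ⟨hcne.mono (hcv.trans subset_closure), hde.symm ▸ hdne, V₂₂, ho₂₂, hn₂₂, ?_⟩⟩
  · rwa [← hde, compl_compl] at hvd
  · rintro L hL hLc ⟨x, hxL, hxv⟩
    by_contra hLV
    exact hxv (hFv (subset_closure ⟨L, ⟨hL, hLc, hLV⟩, hxL⟩))
  · rintro L hL ⟨x, hxL, hxv⟩ hLd
    by_contra hLV
    exact hvG hxv (subset_closure ⟨L, ⟨hL, hde ▸ hLd, hLV⟩, hxL⟩)

omit [T2Space X] [CompactSpace X] [ConnectedSpace X] [Nontrivial X] in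
theorem not_isNowhereDense_of_cutsOff {c u L : Set X} (h : CutsOff c u) (hL : IsSubcontinuum L)
    (hc : (L ∩ c).Nonempty) (hu : (L ∩ uᶜ).Nonempty) : ¬ IsNowhereDense L := by
  intro hnd
  obtain ⟨-, -, V, hV, ⟨x, hx⟩, h⟩ := h
  have : x ∈ interior (closure L) :=
    interior_maximal ((h L hL hc hu).trans subset_closure) hV hx
  exact (hnd ▸ this : x ∈ (∅ : Set X))

end

/-! ### Oscillation on nowhere dense continua -/

/-- `lim` averages its left and right halves. Either one half is constant on `L`, or `L` meets an
end of each half and the sharper bound applies to both. If `L` meets an end of the whole, it cannot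
cross the adjacent half, so the other half is constant; this keeps the induction going. -/
theorem Urysohns.CU.abs_lim_sub_lim_le {X : Type*} [TopologicalSpace X] {L : Set X}
    (hL : IsSubcontinuum L) (hnd : IsNowhereDense L) (n : ℕ) (c : Urysohns.CU (CutsOff (X := X))) :
    (∀ a ∈ L, ∀ b ∈ L, |c.lim a - c.lim b| ≤ 2 * (1 / 2) ^ n) ∧
    ((L ∩ c.C).Nonempty ∨ (L ∩ c.Uᶜ).Nonempty →
      ∀ a ∈ L, ∀ b ∈ L, |c.lim a - c.lim b| ≤ (1 / 2) ^ n) := by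
  induction n generalizing c with
  | zero =>
    have h1 : ∀ a b, |c.lim a - c.lim b| ≤ 1 := fun a b => by
      rw [abs_le]
      constructor <;> linarith [c.lim_nonneg a, c.lim_nonneg b, c.lim_le_one a, c.lim_le_one b]
    refine ⟨fun a _ b _ => (h1 a b).trans (by norm_num), fun _ a _ b _ => (h1 a b).trans ?_⟩
    norm_num
  | succ n ih =>
    have hmid : ∀ x, c.lim x = (c.left.lim x + c.right.lim x) / 2 := fun x => by
      rw [c.lim_eq_midpoint, midpoint_eq_smul_add, invOf_eq_inv, smul_eq_mul]
      ring
    have hp : (1 / 2 : ℝ) ^ (n + 1) = (1 / 2) ^ n / 2 := by rw [pow_succ]; ring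
    have avg : ∀ {a b : X} {r s : ℝ}, |c.left.lim a - c.left.lim b| ≤ r →
        |c.right.lim a - c.right.lim b| ≤ s → |c.lim a - c.lim b| ≤ (r + s) / 2 := by
      intro a b r s h1 h2
      rw [hmid, hmid]
      rw [abs_le] at h1 h2 ⊢
      constructor <;> linarith [h1.1, h1.2, h2.1, h2.2]
    have hl := ih c.left
    have hr := ih c.right
    have cutl : ¬ ((L ∩ c.C).Nonempty ∧ (L ∩ c.left.Uᶜ).Nonempty) := fun h =>
      not_isNowhereDense_of_cutsOff c.left.P_C_U hL h.1 h.2 hnd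
    have cutr : ¬ ((L ∩ c.right.C).Nonempty ∧ (L ∩ c.Uᶜ).Nonempty) := fun h =>
      not_isNowhereDense_of_cutsOff c.right.P_C_U hL h.1 h.2 hnd
    have hleft : ¬ (L ∩ c.left.Uᶜ).Nonempty →
        ∀ a ∈ L, ∀ b ∈ L, |c.right.lim a - c.right.lim b| ≤ 0 := by
      intro h a ha b hb
      have hz : ∀ x ∈ L, c.right.lim x = 0 := fun x hx => c.right.lim_of_mem_C x
        (c.left_U_subset_right_C (not_not.1 fun hxu => h ⟨x, hx, hxu⟩))
      rw [hz a ha, hz b hb]; simp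
    have hright : ¬ (L ∩ c.right.C).Nonempty →
        ∀ a ∈ L, ∀ b ∈ L, |c.left.lim a - c.left.lim b| ≤ 0 := by
      intro h a ha b hb
      have hz : ∀ x ∈ L, c.left.lim x = 1 := fun x hx => c.left.lim_of_notMem_U x
        fun hxu => h ⟨x, hx, c.left_U_subset_right_C hxu⟩
      rw [hz a ha, hz b hb]; simp
    rw [hp]
    constructor
    · intro a ha b hb
      by_cases h1 : (L ∩ c.left.Uᶜ).Nonempty
      · by_cases h2 : (L ∩ c.right.C).Nonempty
        · refine (avg (hl.2 (Or.inr h1) a ha b hb) (hr.2 (Or.inl h2) a ha b hb)).trans ?_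
          linarith
        · refine (avg (hright h2 a ha b hb) (hr.1 a ha b hb)).trans ?_
          linarith
      · refine (avg (hl.1 a ha b hb) (hleft h1 a ha b hb)).trans ?_
        linarith
    · rintro (h | h) a ha b hb
      · have h1 : ¬ (L ∩ c.left.Uᶜ).Nonempty := fun h' => cutl ⟨h, h'⟩
        refine (avg (hl.2 (Or.inl h) a ha b hb) (hleft h1 a ha b hb)).trans ?_
        linarith
      · have h2 : ¬ (L ∩ c.right.C).Nonempty := fun h' => cutr ⟨h', h⟩
        refine (avg (hright h2 a ha b hb) (hr.2 (Or.inr h) a ha b hb)).trans ?_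
        linarith

theorem Urysohns.CU.lim_eq_of_isNowhereDense {X : Type*} [TopologicalSpace X] {L : Set X}
    (hL : IsSubcontinuum L) (hnd : IsNowhereDense L) (c : Urysohns.CU (CutsOff (X := X)))
    {a b : X} (ha : a ∈ L) (hb : b ∈ L) : c.lim a = c.lim b := by
  have ht : Filter.Tendsto (fun n : ℕ => 2 * (1 / 2 : ℝ) ^ n) Filter.atTop (𝓝 (2 * 0)) :=
    (tendsto_pow_atTop_nhds_zero_of_lt_one (by norm_num) (by norm_num)).const_mul 2
  have := ge_of_tendsto' ht fun n => (abs_lim_sub_lim_le hL hnd n c).1 a ha b hb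
  rw [mul_zero] at this
  exact sub_eq_zero.1 (abs_nonpos_iff.1 this)

/-! ### Closed maps, circles and local connectedness -/

/-- Under a closed continuous surjection with connected fibers, preimages of subcontinua are
subcontinua. -/
theorem IsSubcontinuum.preimage_of_isClosedMap {X Y : Type*} [TopologicalSpace X]
    [CompactSpace X] [TopologicalSpace Y] [T2Space Y] {f : X → Y} (hf : Continuous f)
    (hfc : IsClosedMap f) (hfs : Function.Surjective f)
    (hfib : ∀ y, IsPreconnected (f ⁻¹' {y})) {L : Set Y} (hL : IsSubcontinuum L) :
    IsSubcontinuum (f ⁻¹' L) := by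
  have hc : IsClosed (f ⁻¹' L) := hL.1.isClosed.preimage hf
  refine ⟨hc.isCompact, hL.2.1.preimage hfs, isPreconnected_closed_iff.2 ?_⟩
  intro u v hu hv huv ⟨a, haL, hau⟩ ⟨b, hbL, hbv⟩
  -- The images of the two closed parts share a point `y`; the connected fiber over it meets both.
  obtain ⟨y, hyL, ⟨s, ⟨hsL, hsu⟩, hsy⟩, ⟨t, ⟨htL, htv⟩, hty⟩⟩ :=
    isPreconnected_closed_iff.1 hL.2.2 (f '' (f ⁻¹' L ∩ u)) (f '' (f ⁻¹' L ∩ v))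
      (hfc _ (hc.inter hu)) (hfc _ (hc.inter hv))
      (by
        intro y hy
        obtain ⟨x, rfl⟩ := hfs y
        rcases huv hy with h | h
        · exact Or.inl ⟨x, ⟨hy, h⟩, rfl⟩
        · exact Or.inr ⟨x, ⟨hy, h⟩, rfl⟩)
      ⟨f a, haL, a, ⟨haL, hau⟩, rfl⟩ ⟨f b, hbL, b, ⟨hbL, hbv⟩, rfl⟩
  have hsub : f ⁻¹' {y} ⊆ f ⁻¹' L := preimage_mono (singleton_subset_iff.2 hyL)
  exact (isPreconnected_closed_iff.1 (hfib y) u v hu hv (hsub.trans huv) ⟨s, hsy, hsu⟩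
    ⟨t, hty, htv⟩).mono (inter_subset_inter_left _ hsub)

theorem HereditarilyUnicoherent.of_isClosedMap {X Y : Type*} [TopologicalSpace X]
    [CompactSpace X] [TopologicalSpace Y] [T2Space Y] {f : X → Y} (hf : Continuous f)
    (hfc : IsClosedMap f) (hfs : Function.Surjective f)
    (hfib : ∀ y, IsPreconnected (f ⁻¹' {y})) (hX : HereditarilyUnicoherent X) :
    HereditarilyUnicoherent Y := by
  intro A B hA hB
  have := (hX _ _ (hA.preimage_of_isClosedMap hf hfc hfs hfib)
    (hB.preimage_of_isClosedMap hf hfc hfs hfib)).image f hf.continuousOn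
  rwa [← preimage_inter, image_preimage_eq _ hfs] at this

/-- The circle is the union of two arcs whose intersection is finite and not connected. -/
theorem HereditarilyUnicoherent.not_homeomorph_circle {Y : Type*} [TopologicalSpace Y]
    (hY : HereditarilyUnicoherent Y) (S : Set Y) : ¬ Nonempty (S ≃ₜ Circle) := by
  rintro ⟨e⟩
  let g : Circle → Y := fun z => (e.symm z : Y)
  have hg : IsEmbedding g := IsEmbedding.subtypeVal.comp e.symm.isEmbedding
  have harc : ∀ a b : ℝ, a ≤ b → IsSubcontinuum (g '' (Circle.exp '' Icc a b)) := fun a b hab =>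
    ⟨(isCompact_Icc.image Circle.exp.continuous).image hg.continuous,
      ((isConnected_Icc hab).image _ Circle.exp.continuous.continuousOn).image _
        hg.continuous.continuousOn⟩
  have hpi := Real.pi_pos
  have hAB := hY _ _ (harc 0 Real.pi hpi.le) (harc (-Real.pi) 0 (by linarith))
  rw [← image_inter hg.injective, hg.isInducing.isPreconnected_image] at hAB
  have hsub : Circle.exp '' Icc 0 Real.pi ∩ Circle.exp '' Icc (-Real.pi) 0 ⊆
      {Circle.exp 0, Circle.exp Real.pi} := by
    rintro _ ⟨⟨s, ⟨hs0, hsp⟩, rfl⟩, ⟨t, ⟨htp, ht0⟩, hts⟩⟩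
    have him : Real.sin t = Real.sin s := by
      have := congrArg (fun z : Circle => (z : ℂ).im) hts
      simpa [Circle.coe_exp, Complex.exp_ofReal_mul_I_im] using this
    have h1 := Real.sin_nonneg_of_nonneg_of_le_pi hs0 hsp
    have h2 := Real.sin_nonpos_of_nonpos_of_neg_pi_le ht0 htp
    rcases hs0.eq_or_lt with rfl | hs0
    · exact Or.inl rfl
    rcases hsp.eq_or_lt with rfl | hsp
    · exact Or.inr rfl
    linarith [Real.sin_pos_of_pos_of_lt_pi hs0 hsp]
  refine hAB.infinite_of_nontrivial ?_ (Set.Finite.subset (by simp) hsub)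
  refine ⟨Circle.exp 0, ⟨⟨0, by simp [hpi.le], rfl⟩, ⟨0, by simp [hpi.le], rfl⟩⟩,
    Circle.exp Real.pi, ⟨⟨Real.pi, by simp [hpi.le], rfl⟩, ⟨-Real.pi, by simp [hpi.le], ?_⟩⟩, ?_⟩
  · apply Circle.ext; simp [Circle.coe_exp]
  · intro h
    have := congrArg (fun z : Circle => (z : ℂ)) h
    simp [Circle.coe_exp] at this
    norm_num at this

/-- A Hausdorff image of a second countable compact space is second countable. -/
theorem SecondCountableTopology.of_isClosedMap {X Y : Type*} [TopologicalSpace X]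
    [CompactSpace X] [SecondCountableTopology X] [TopologicalSpace Y] [T2Space Y] {f : X → Y}
    (hf : Continuous f) (hfc : IsClosedMap f) (hfs : Function.Surjective f) :
    SecondCountableTopology Y := by
  let B := TopologicalSpace.countableBasis X
  have hB : TopologicalSpace.IsTopologicalBasis B := TopologicalSpace.isBasis_countableBasis X
  let E : Set (Set Y) := (fun s : Set (Set X) => (f '' (⋃₀ s)ᶜ)ᶜ) '' {s | s.Finite ∧ s ⊆ B}
  have hE : E.Countable :=
    (countable_ofPred_finite_subset (TopologicalSpace.countable_countableBasis X)).image _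
  refine (TopologicalSpace.isTopologicalBasis_of_isOpen_of_nhds (s := E) ?_ ?_
    ).secondCountableTopology hE
  · rintro _ ⟨s, ⟨-, hs⟩, rfl⟩
    exact (hfc _ (isOpen_sUnion fun t ht => hB.isOpen (hs ht)).isClosed_compl).isOpen_compl
  · intro y W hy hW
    obtain ⟨S, hSB, hS⟩ := hB.open_eq_sUnion (hW.preimage hf)
    have hK : IsCompact (f ⁻¹' {y}) := (isClosed_singleton.preimage hf).isCompact
    obtain ⟨T, hTS, hTf, hT⟩ := hK.elim_finite_subcover_image (b := S) (c := id)
      (fun t ht => hB.isOpen (hSB ht))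
      (by
        simp only [id, ← sUnion_eq_biUnion, ← hS]
        exact preimage_mono (singleton_subset_iff.2 hy))
    refine ⟨_, ⟨T, ⟨hTf, hTS.trans hSB⟩, rfl⟩, ?_, ?_⟩
    · rintro ⟨x, hx, hxy⟩
      refine hx ?_
      simpa only [id, ← sUnion_eq_biUnion] using hT hxy
    · intro z hz
      obtain ⟨x, rfl⟩ := hfs z
      by_contra hxW
      refine hz ⟨x, fun hx => hxW ?_, rfl⟩
      have : x ∈ f ⁻¹' W := hS ▸ sUnion_mono hTS hx
      exact this

/-- If any two points have neighborhoods such that all subcontinua joining them pass through a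
common point, then the continuum is locally connected. -/
theorem locallyConnectedSpace_of_forall_exists_mem {Y : Type*} [TopologicalSpace Y]
    [T2Space Y] [CompactSpace Y] [ConnectedSpace Y]
    (h : ∀ p q : Y, p ≠ q → ∃ O O' : Set Y, IsOpen O ∧ IsOpen O' ∧ p ∈ O ∧ q ∈ O' ∧ ∃ s : Y,
      ∀ L, IsSubcontinuum L → (L ∩ O).Nonempty → (L ∩ O').Nonempty → s ∈ L) :
    LocallyConnectedSpace Y := by
  rw [locallyConnectedSpace_iff_connected_subsets]
  intro z W hW
  obtain ⟨W', hW'W, hW', hzW'⟩ := mem_nhds_iff.1 hW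
  obtain ⟨U, hU, hzU, hUW⟩ := normal_exists_closure_subset isClosed_singleton hW'
    (singleton_subset_iff.2 hzW')
  rw [singleton_subset_iff] at hzU
  by_cases huniv : U = univ
  · refine ⟨univ, Filter.univ_mem, isPreconnected_univ, ?_⟩
    rw [← huniv]
    exact subset_closure.trans (hUW.trans hW'W)
  have hne : ∀ q ∈ frontier U, z ≠ q := by
    rintro q hq rfl
    rw [hU.frontier_eq] at hq
    exact hq.2 hzU
  choose! O O' hO hO' hzO hqO' s hs using h z
  obtain ⟨t, htF, htf, ht⟩ := isClosed_frontier.isCompact.elim_finite_subcover_image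
    (b := frontier U) (c := O') (fun q hq => hO' q (hne q hq))
    (fun q hq => mem_biUnion hq (hqO' q (hne q hq)))
  let K := closure U
  let C : Y → Set Y := fun y => connectedComponentIn K y
  -- Near `z`, the component of a point in `K` reaches the frontier, hence contains some `s q`. Only
  -- finitely many components arise, and those missing `z` form a closed set to be avoided.
  let t' := {q ∈ t | s q ∈ K ∧ z ∉ C (s q)}
  have hclosed : IsClosed (⋃ q ∈ t', C (s q)) :=
    (htf.subset (sep_subset _ _)).isClosed_biUnion fun q hq =>
      (isSubcontinuum_connectedComponentIn isClosed_closure hq.2.1).1.isClosed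
  have hzt : z ∉ ⋃ q ∈ t', C (s q) := by
    intro hz
    obtain ⟨q, hq, hz⟩ := mem_iUnion₂.1 hz
    exact hq.2.2 hz
  refine ⟨C z, ?_, isPreconnected_connectedComponentIn,
    (connectedComponentIn_subset _ _).trans (hUW.trans hW'W)⟩
  have hopen : IsOpen (⋂ q ∈ t, O q) :=
    htf.isOpen_biInter fun q hq => hO q (hne q (htF hq))
  filter_upwards [hU.mem_nhds hzU, hclosed.isOpen_compl.mem_nhds hzt,
    hopen.mem_nhds (mem_iInter₂.2 fun q hq => hzO q (hne q (htF hq)))] with x hxU hxt hxO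
  have hxK : x ∈ K := subset_closure hxU
  obtain ⟨w, hwC, hwf⟩ := connectedComponentIn_inter_frontier_nonempty hU huniv hxU
  obtain ⟨q, hqt, hwq⟩ := mem_iUnion₂.1 (ht hwf)
  have hsC : s q ∈ C x := hs q (hne q (htF hqt)) _
    (isSubcontinuum_connectedComponentIn isClosed_closure hxK)
    ⟨x, mem_connectedComponentIn hxK, mem_iInter₂.1 hxO q hqt⟩ ⟨w, hwC, hwq⟩
  have heq : C x = C (s q) := connectedComponentIn_eq hsC
  have hzC : z ∈ C (s q) := by
    by_contra hzC
    refine hxt (mem_iUnion₂.2 ⟨q, ⟨hqt, connectedComponentIn_subset _ _ hsC, hzC⟩, ?_⟩)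
    rw [← heq]
    exact mem_connectedComponentIn hxK
  have : C (s q) = C z := connectedComponentIn_eq hzC
  rw [← this, ← heq]
  exact mem_connectedComponentIn hxK

/-! ### Meager composants and their quotient -/

section

variable {X : Type*} [TopologicalSpace X]

theorem mem_meagerComposant_iff {x y : X} : y ∈ meagerComposant x ↔
    ∃ L, IsSubcontinuum L ∧ IsNowhereDense L ∧ x ∈ L ∧ y ∈ L :=
  ⟨fun ⟨L, ⟨h1, h2, h3⟩, h4⟩ => ⟨L, h1, h2, h3, h4⟩,
    fun ⟨L, h1, h2, h3, h4⟩ => ⟨L, ⟨h1, h2, h3⟩, h4⟩⟩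

theorem mem_meagerComposant_comm {x y : X} :
    y ∈ meagerComposant x ↔ x ∈ meagerComposant y := by
  simp only [mem_meagerComposant_iff, and_comm (a := x ∈ _)]

variable [T2Space X]

theorem mem_meagerComposant_trans {x y z : X} (hxy : y ∈ meagerComposant x)
    (hyz : z ∈ meagerComposant y) : z ∈ meagerComposant x := by
  rw [mem_meagerComposant_iff] at *
  obtain ⟨L, hL, hLn, hxL, hyL⟩ := hxy
  obtain ⟨K, hK, hKn, hyK, hzK⟩ := hyz
  refine ⟨L ∪ K, hL.union hK ⟨y, hyL, hyK⟩, ?_, Or.inl hxL, Or.inr hzK⟩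
  rw [IsNowhereDense, hL.1.isClosed.closure_eq] at hLn
  rw [IsNowhereDense, hK.1.isClosed.closure_eq] at hKn
  rw [IsNowhereDense, (hL.1.isClosed.union hK.1.isClosed).closure_eq,
    interior_union_isClosed_of_interior_empty hL.1.isClosed hKn, hLn]

theorem meagerComposant_eq {x y : X} (h : y ∈ meagerComposant x) :
    meagerComposant y = meagerComposant x :=
  Subset.antisymm (fun _ hz => mem_meagerComposant_trans h hz)
    fun _ hz => mem_meagerComposant_trans (mem_meagerComposant_comm.1 h) hz

omit [T2Space X] in
theorem isPreconnected_meagerComposant (x : X) : IsPreconnected (meagerComposant x) :=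
  isPreconnected_sUnion x _ (fun _ hL => hL.2.2) fun _ hL => hL.1.2.2

variable [ConnectedSpace X] [Nontrivial X]

theorem mem_meagerComposant_self (x : X) : x ∈ meagerComposant x := by
  rw [mem_meagerComposant_iff]
  refine ⟨{x}, isSubcontinuum_singleton x, ?_, rfl, rfl⟩
  rw [IsNowhereDense, closure_singleton, interior_singleton]

theorem meagerComposant_eq_iff {x y : X} :
    meagerComposant y = meagerComposant x ↔ y ∈ meagerComposant x :=
  ⟨fun h => h ▸ mem_meagerComposant_self y, meagerComposant_eq⟩

theorem isPartition_meagerComposants : Setoid.IsPartition (meagerComposants X) := by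
  refine ⟨?_, fun a => ⟨meagerComposant a, ⟨⟨a, rfl⟩, mem_meagerComposant_self a⟩, ?_⟩⟩
  · rintro ⟨x, hx⟩
    exact (hx ▸ mem_meagerComposant_self x : x ∈ (∅ : Set X))
  · rintro _ ⟨⟨x, rfl⟩, ha⟩
    exact (meagerComposant_eq ha).symm

namespace MeagerComposantSpace

theorem mk_eq_mk_iff {x y : X} :
    (mk y : MeagerComposantSpace X) = mk x ↔ y ∈ meagerComposant x := by
  rw [← meagerComposant_eq_iff]
  exact Subtype.ext_iff

theorem preimage_mk_singleton (x : X) : mk ⁻¹' {(mk x : MeagerComposantSpace X)} =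
    meagerComposant x := by
  ext y
  exact mk_eq_mk_iff

end MeagerComposantSpace

end

namespace MeagerComposantSpace

variable {X : Type*} [TopologicalSpace X]

theorem surjective_mk : Function.Surjective (mk : X → MeagerComposantSpace X) := by
  rintro ⟨_, x, rfl⟩
  exact ⟨x, rfl⟩

theorem continuous_mk : Continuous (mk : X → MeagerComposantSpace X) :=
  continuous_coinduced_rng

end MeagerComposantSpace

section

variable {X : Type*} [TopologicalSpace X] [T2Space X] [CompactSpace X] [ConnectedSpace X]

theorem cutsOff_of_notMem_meagerComposant (hX : HereditarilyUnicoherent X) {x y : X}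
    (h : y ∉ meagerComposant x) : CutsOff {x} {y}ᶜ := by
  set N := ⋂₀ {L : Set X | IsSubcontinuum L ∧ {x, y} ⊆ L}
  have hN : IsSubcontinuum N := hX.isSubcontinuum_hull (insert_nonempty _ _)
  have hxyN : {x, y} ⊆ N := fun z hz L hL => hL.2 hz
  refine ⟨singleton_nonempty x, by simp, interior N, isOpen_interior, ?_, ?_⟩
  · rw [nonempty_iff_ne_empty]
    intro hemp
    refine h (mem_meagerComposant_iff.2 ⟨N, hN, ?_, hxyN (by simp), hxyN (by simp)⟩)
    rw [IsNowhereDense, hN.1.isClosed.closure_eq, hemp]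
  · rintro L hL ⟨a, haL, rfl⟩ ⟨b, hbL, hb⟩
    obtain rfl : b = y := by simpa using hb
    refine interior_subset.trans (sInter_subset_of_mem ⟨hL, ?_⟩)
    rintro z (rfl | rfl) <;> assumption

omit [T2Space X] [CompactSpace X] [ConnectedSpace X] in
theorem meagerComposant_subset_of_cutsOff {c u : Set X} {x : X} (h : CutsOff c u)
    (hx : x ∈ c) : meagerComposant x ⊆ u := by
  intro z hz
  by_contra hzu
  obtain ⟨L, hL, hLn, hxL, hzL⟩ := mem_meagerComposant_iff.1 hz
  exact not_isNowhereDense_of_cutsOff h hL ⟨x, hxL, hx⟩ ⟨z, hzL, hzu⟩ hLn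

variable [Nontrivial X]

theorem MeagerComposantSpace.t2Space (hX : HereditarilyUnicoherent X)
    (hind : ∀ K : Set X, IsIndecomposableSubcontinuum K → IsNowhereDense K) :
    T2Space (MeagerComposantSpace X) := by
  refine ⟨fun p q hpq => ?_⟩
  obtain ⟨x, rfl⟩ := surjective_mk p
  obtain ⟨y, rfl⟩ := surjective_mk q
  have hyx : y ∉ meagerComposant x := fun h => hpq (mk_eq_mk_iff.2 h).symm
  let c : Urysohns.CU (CutsOff (X := X)) :=
    { C := {x}
      U := {y}ᶜ
      P_C_U := cutsOff_of_notMem_meagerComposant hX hyx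
      closed_C := isClosed_singleton
      open_U := isOpen_compl_singleton
      subset := by
        rintro z rfl rfl
        exact hyx (mem_meagerComposant_self _)
      hP := fun hc h hu _ => h.interpolate hX hind hc hu }
  -- The choice of representative is harmless: two representatives lie in a common nowhere dense
  -- subcontinuum, where `c.lim` is constant.
  let g : MeagerComposantSpace X → ℝ := fun p => c.lim (surjective_mk p).choose
  have hg : ∀ z, g (mk z) = c.lim z := by
    intro z
    have h := mk_eq_mk_iff.1 (surjective_mk (mk z)).choose_spec
    obtain ⟨L, hL, hLn, hzL, hL'⟩ := mem_meagerComposant_iff.1 h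
    exact c.lim_eq_of_isNowhereDense hL hLn hL' hzL
  have hgc : Continuous g := by
    refine continuous_coinduced_dom.2 ?_
    have : g ∘ mk = c.lim := funext hg
    rw [this]
    exact c.continuous_lim
  refine separated_by_continuous hgc ?_
  rw [hg, hg, c.lim_of_mem_C x rfl, c.lim_of_notMem_U y fun h => h rfl]
  exact zero_ne_one

namespace MeagerComposantSpace

theorem isClosedMap_mk (hX : HereditarilyUnicoherent X)
    (hind : ∀ K : Set X, IsIndecomposableSubcontinuum K → IsNowhereDense K) :
    IsClosedMap (mk : X → MeagerComposantSpace X) :=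
  have := t2Space hX hind
  continuous_mk.isClosedMap

omit [CompactSpace X] in
theorem isPreconnected_fiber (p : MeagerComposantSpace X) :
    IsPreconnected (mk ⁻¹' {p}) := by
  obtain ⟨x, rfl⟩ := surjective_mk p
  rw [preimage_mk_singleton]
  exact isPreconnected_meagerComposant x

/-- Interpolate twice between `x` and `y`. `O` consists of the composants inside `v`, `O'` of those
missing `closure w`, and `s` comes from the open set cutting `closure v` from `wᶜ`. -/
theorem exists_common_point (hX : HereditarilyUnicoherent X)
    (hind : ∀ K : Set X, IsIndecomposableSubcontinuum K → IsNowhereDense K)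
    (p q : MeagerComposantSpace X) (hpq : p ≠ q) :
    ∃ O O' : Set (MeagerComposantSpace X), IsOpen O ∧ IsOpen O' ∧ p ∈ O ∧ q ∈ O' ∧
      ∃ s, ∀ L, IsSubcontinuum L → (L ∩ O).Nonempty → (L ∩ O').Nonempty → s ∈ L := by
  have := t2Space hX hind
  have hcl := isClosedMap_mk hX hind
  obtain ⟨x, rfl⟩ := surjective_mk p
  obtain ⟨y, rfl⟩ := surjective_mk q
  have hyx : y ∉ meagerComposant x := fun h => hpq (mk_eq_mk_iff.2 h).symm
  obtain ⟨v, hv, -, -, hxv, hvy⟩ := (cutsOff_of_notMem_meagerComposant hX hyx).interpolate hX hind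
    isClosed_singleton isOpen_compl_singleton
  obtain ⟨w, hw, -, -, hvw, hwy⟩ := hvy.interpolate hX hind isClosed_closure
    isOpen_compl_singleton
  obtain ⟨-, -, V, -, ⟨s, hs⟩, hV⟩ := hvw
  refine ⟨(mk '' vᶜ)ᶜ, (mk '' closure w)ᶜ, (hcl _ hv.isClosed_compl).isOpen_compl,
    (hcl _ isClosed_closure).isOpen_compl, ?_, ?_, mk s, ?_⟩
  · rintro ⟨z, hz, hzx⟩
    exact hz (meagerComposant_subset_of_cutsOff hxv rfl (mk_eq_mk_iff.1 hzx))
  · rintro ⟨z, hz, hzy⟩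
    exact meagerComposant_subset_of_cutsOff hwy hz (mk_eq_mk_iff.1 hzy.symm) rfl
  · rintro L hL ⟨a, haL, ha⟩ ⟨b, hbL, hb⟩
    obtain ⟨a, rfl⟩ := surjective_mk a
    obtain ⟨b, rfl⟩ := surjective_mk b
    refine hV _ (hL.preimage_of_isClosedMap continuous_mk hcl surjective_mk isPreconnected_fiber)
      ⟨a, haL, subset_closure ?_⟩ ⟨b, hbL, ?_⟩ hs
    · by_contra hav
      exact ha ⟨a, hav, rfl⟩
    · exact fun hbw => hb ⟨b, subset_closure hbw, rfl⟩

end MeagerComposantSpace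

end

/-- A one-point space is indecomposable but not nowhere dense in itself. -/
theorem nontrivial_of_isNowhereDense_of_indecomposable {X : Type*} [TopologicalSpace X]
    [CompactSpace X] [ConnectedSpace X]
    (hind : ∀ K : Set X, IsIndecomposableSubcontinuum K → IsNowhereDense K) : Nontrivial X := by
  by_contra hnt
  rw [not_nontrivial_iff_subsingleton] at hnt
  have hnd := hind univ ⟨⟨isCompact_univ, isConnected_univ⟩, by
    rintro ⟨-, A, -, hA, -, hAu, -, -⟩
    exact hAu hA.2.1.eq_univ⟩
  rw [IsNowhereDense, closure_univ, interior_univ] at hnd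
  exact univ_nonempty.ne_empty hnd

theorem theorem12 (X : Type*) [MetricSpace X] [CompactSpace X] [ConnectedSpace X]
    (hX : HereditarilyUnicoherent X)
    (hind : ∀ K : Set X, IsIndecomposableSubcontinuum K → IsNowhereDense K) :
    Setoid.IsPartition (meagerComposants X) ∧
      (∀ A : Set X, IsClosed A → IsClosed (⋃ x ∈ A, meagerComposant x)) ∧
      IsDendrite (MeagerComposantSpace X) := by
  have := nontrivial_of_isNowhereDense_of_indecomposable hind
  have hcont : Continuous (MeagerComposantSpace.mk : X → MeagerComposantSpace X) :=
    MeagerComposantSpace.continuous_mk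
  have hsurj := MeagerComposantSpace.surjective_mk (X := X)
  have hcl := MeagerComposantSpace.isClosedMap_mk hX hind
  have hT2 := MeagerComposantSpace.t2Space hX hind
  have hcomp : CompactSpace (MeagerComposantSpace X) := hsurj.compactSpace hcont
  have hconn : ConnectedSpace (MeagerComposantSpace X) := hsurj.connectedSpace hcont
  have hsc : SecondCountableTopology (MeagerComposantSpace X) :=
    SecondCountableTopology.of_isClosedMap hcont hcl hsurj
  refine ⟨isPartition_meagerComposants, fun A hA => ?_, hcomp, hconn, inferInstance,
    locallyConnectedSpace_of_forall_exists_mem (MeagerComposantSpace.exists_common_point hX hind),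
    (hX.of_isClosedMap hcont hcl hsurj
      MeagerComposantSpace.isPreconnected_fiber).not_homeomorph_circle⟩
  -- The union is the saturation of `A`, closed because the quotient map is.
  have heq : ⋃ x ∈ A, meagerComposant x =
      MeagerComposantSpace.mk ⁻¹' (MeagerComposantSpace.mk '' A) := by
    ext z
    simp only [Set.mem_iUnion₂, Set.mem_preimage, Set.mem_image, exists_prop,
      MeagerComposantSpace.mk_eq_mk_iff]
    exact exists_congr fun x => and_congr_right fun _ => mem_meagerComposant_comm
  rw [heq]
  exact (hcl A hA).preimage hcont
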